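/- Let $F_0=0$, $F_1=1$, $F_i=F_{i-1}+F_{i-2}$ be the Fibonacci numbers. Let $P$ be a polynomial with real coefficients and positive leading coefficient, and let $m$ be a natural number such that $P(m)<P(m+1)<P(m+2)<\cdots$ are positive integers and $F_i>P(i)$ for all $i\ge m$. A composition of $n$ is a finite sequence of positive integers with sum $n$. For $k\ge m$ let $t_k(n)$ be the number of compositions of $n$ all of whose parts lie in $\{P(k),P(k+1),P(k+2),\dots\}$, and let $r_k(n)$ be the number of compositions of $n$ all of whose parts lie in $\{F_k,F_{k+1},F_{k+2},\dots\}$. Let $d_k=\gcd\{P(i): i\ge k\}$ (so that $t_k(n)=0$ unless $d_k\mid n$). Then, for every $k\ge m$, $$\lim_{\substack{n\to\infty\\ d_k\mid n}}\frac{t_k(n)}{r_k(n)}=+\infty .$$ In particular, if $d_k=1$, then $$\lim_{n\to\infty}\frac{t_k(n)}{r_k(n)}=+\infty .$$ (The quotient is defined for all large $n$, because $r_k(n)>0$ for all large $n$.) -/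

import Mathlib

open Filter

/-- The set `{P(k), P(k+1), P(k+2), …} ∩ ℕ` of natural numbers attained by the real polynomial `P`
at the integers `i ≥ k`. -/
def polyParts (P : Polynomial ℝ) (k : ℕ) : Set ℕ :=
  {a | ∃ i : ℕ, k ≤ i ∧ P.eval (i : ℝ) = (a : ℝ)}

/-- The set `{F_k, F_{k+1}, F_{k+2}, …}` of Fibonacci numbers (`F_0 = 0`, `F_1 = 1`). -/
def fibParts (k : ℕ) : Set ℕ :=
  {a | ∃ i : ℕ, k ≤ i ∧ Nat.fib i = a}

/-- The number of compositions of `n` (ordered sums of positive integers) all of whose parts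
belong to `S`. -/
noncomputable def compositionCount (S : Set ℕ) (n : ℕ) : ℕ :=
  Nat.card {c : Composition n // ∀ a ∈ c.blocks, a ∈ S}

/-!
Let `β ∈ (0, 1)` be the root of `∑ β ^ F_i = 1`, the sum running over `i ≥ k`. Splitting off the
first part of a composition gives `r_k(n) ≤ β ^ (-n)` by induction. As `P(i) < F_i`, some finite
partial sum of `∑ β ^ P(i)` exceeds `1`, hence so does the same partial sum of `∑ x ^ P(i)` for
some `x < β`. Now the same recursion gives `t_k(n) ≥ c x ^ (-n)` for all large `n` divisible by
`d_k`, so the quotient is at least `c (β / x) ^ n`.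
-/

section Recursion

variable {S : Set ℕ}

open Classical in
/-- Splitting off the first part of a composition of `n ≠ 0` with all parts in `S`. -/
def compositionConsEquiv (S : Set ℕ) {n : ℕ} (hn : n ≠ 0) :
    {c : Composition n // ∀ a ∈ c.blocks, a ∈ S} ≃
      Σ a : {a // a ∈ {a ∈ Finset.Icc 1 n | a ∈ S}},
        {c : Composition (n - a) // ∀ b ∈ c.blocks, b ∈ S} where
  toFun
    | ⟨⟨[], _, hsum⟩, _⟩ => absurd hsum.symm hn
    | ⟨⟨a :: l, hpos, hsum⟩, hS⟩ =>
      ⟨⟨a, by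
          have : 0 < a := hpos List.mem_cons_self
          rw [List.sum_cons] at hsum
          exact Finset.mem_filter.2
            ⟨Finset.mem_Icc.2 ⟨this, by lia⟩, hS a List.mem_cons_self⟩⟩,
        ⟨l, fun h => hpos (List.mem_cons_of_mem _ h), by
          rw [List.sum_cons] at hsum; dsimp only; lia⟩,
        fun b hb => hS b (List.mem_cons_of_mem _ hb)⟩
  invFun := fun ⟨⟨a, ha⟩, c, hS⟩ =>
    have ha' := Finset.mem_filter.1 ha
    have haIcc := Finset.mem_Icc.1 ha'.1
    ⟨⟨a :: c.blocks, fun hi => (List.mem_cons.1 hi).elim (fun h => h ▸ haIcc.1) c.blocks_pos,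
        by rw [List.sum_cons, c.blocks_sum]; exact Nat.add_sub_of_le haIcc.2⟩,
      List.forall_mem_cons.2 ⟨ha'.2, hS⟩⟩
  left_inv := by
    rintro ⟨⟨_ | ⟨a, l⟩, hpos, hsum⟩, hS⟩
    · exact absurd hsum.symm hn
    · rfl
  right_inv _ := rfl

open Classical in
theorem compositionCount_eq_sum (S : Set ℕ) {n : ℕ} (hn : n ≠ 0) :
    compositionCount S n = ∑ a ∈ Finset.Icc 1 n with a ∈ S, compositionCount S (n - a) := by
  rw [compositionCount, Nat.card_congr (compositionConsEquiv S hn), Nat.card_sigma]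
  exact Finset.sum_coe_sort _ fun a => compositionCount S (n - a)

theorem sum_compositionCount_sub_le {A : Finset ℕ} {n : ℕ} (hAS : (A : Set ℕ) ⊆ S)
    (hAn : A ⊆ Finset.Icc 1 n) :
    ∑ a ∈ A, compositionCount S (n - a) ≤ compositionCount S n := by
  classical
  rcases eq_or_ne n 0 with rfl | hn
  · simp [Finset.subset_empty.1 hAn]
  · rw [compositionCount_eq_sum S hn]
    exact Finset.sum_le_sum_of_subset fun a ha => Finset.mem_filter.2 ⟨hAn ha, hAS ha⟩

theorem compositionCount_pos_of_mem_closure (hS : ∀ a ∈ S, 0 < a) {n : ℕ}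
    (hn : n ∈ AddSubmonoid.closure S) : 0 < compositionCount S n := by
  obtain ⟨l, hl, hsum⟩ := AddSubmonoid.exists_list_of_mem_closure hn
  exact Nat.card_pos_iff.2 ⟨⟨⟨l, fun hi => hS _ (hl _ hi), hsum⟩, hl⟩, inferInstance⟩

theorem compositionCount_zero (S : Set ℕ) : compositionCount S 0 = 1 := by
  have hblocks (c : Composition 0) : c.blocks = [] :=
    List.eq_nil_iff_forall_not_mem.2 fun i hi =>
      (c.blocks_pos hi).ne' (List.sum_eq_zero_iff.1 c.blocks_sum i hi)
  exact Nat.card_eq_one_iff_unique.2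
    ⟨⟨fun c d => Subtype.ext (Composition.ext ((hblocks c).trans (hblocks d).symm))⟩,
      ⟨⟨⟨[], by simp, rfl⟩, by simp⟩⟩⟩

theorem exists_forall_ge_compositionCount_pos (hS : ∀ a ∈ S, 0 < a) :
    ∃ N, ∀ n ≥ N, Nat.setGcd S ∣ n → 0 < compositionCount S n := by
  obtain ⟨N, hN⟩ := Nat.exists_mem_closure_of_ge S
  exact ⟨N, fun n hn hdvd => compositionCount_pos_of_mem_closure hS (hN n hn hdvd)⟩

end Recursion

section Growth

variable {S T : Set ℕ} {x β : ℝ}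

theorem compositionCount_mul_pow_le_one (hx : 0 ≤ x)
    (hsum : ∀ A : Finset ℕ, (A : Set ℕ) ⊆ S → ∑ a ∈ A, x ^ a ≤ 1) (n : ℕ) :
    compositionCount S n * x ^ n ≤ 1 := by
  classical
  induction n using Nat.strong_induction_on with
  | _ n ih =>
    rcases eq_or_ne n 0 with rfl | hn
    · simp [compositionCount_zero]
    calc (compositionCount S n : ℝ) * x ^ n
        = ∑ a ∈ Finset.Icc 1 n with a ∈ S, compositionCount S (n - a) * x ^ n := by
          rw [compositionCount_eq_sum S hn, Nat.cast_sum, Finset.sum_mul]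
      _ ≤ ∑ a ∈ Finset.Icc 1 n with a ∈ S, x ^ a := Finset.sum_le_sum fun a ha => by
          obtain ⟨ha1, han⟩ := Finset.mem_Icc.1 (Finset.mem_filter.1 ha).1
          rw [← pow_sub_mul_pow x han, ← mul_assoc]
          exact mul_le_of_le_one_left (pow_nonneg hx a) (ih (n - a) (by lia))
      _ ≤ 1 := hsum _ fun a ha => (Finset.mem_filter.1 ha).2

theorem le_compositionCount_mul_pow {A : Finset ℕ} {n : ℕ} {c : ℝ} (hx : 0 ≤ x)
    (hAS : (A : Set ℕ) ⊆ S) (hAn : A ⊆ Finset.Icc 1 n) (hsum : 1 ≤ ∑ a ∈ A, x ^ a) (hc : 0 ≤ c)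
    (hrec : ∀ a ∈ A, c ≤ compositionCount S (n - a) * x ^ (n - a)) :
    c ≤ compositionCount S n * x ^ n :=
  calc c ≤ c * ∑ a ∈ A, x ^ a := le_mul_of_one_le_right hc hsum
    _ = ∑ a ∈ A, c * x ^ a := Finset.mul_sum _ _ _
    _ ≤ ∑ a ∈ A, compositionCount S (n - a) * x ^ n := Finset.sum_le_sum fun a ha => by
        rw [← pow_sub_mul_pow x (Finset.mem_Icc.1 (hAn ha)).2, ← mul_assoc]
        exact mul_le_mul_of_nonneg_right (hrec a ha) (pow_nonneg hx a)
    _ = (∑ a ∈ A, compositionCount S (n - a) : ℕ) * x ^ n := by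
        rw [Nat.cast_sum, Finset.sum_mul]
    _ ≤ compositionCount S n * x ^ n := by
        gcongr
        exact sum_compositionCount_sub_le hAS hAn

theorem exists_pos_le_compositionCount_mul_pow (hS : ∀ a ∈ S, 0 < a) (hx : 0 < x) (hx1 : x ≤ 1)
    {A : Finset ℕ} (hAS : (A : Set ℕ) ⊆ S) (hsum : 1 ≤ ∑ a ∈ A, x ^ a) :
    ∃ c > 0, ∃ N, ∀ n ≥ N, Nat.setGcd S ∣ n → c ≤ compositionCount S n * x ^ n := by
  obtain ⟨N, hN⟩ := exists_forall_ge_compositionCount_pos hS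
  -- Beyond `N + A.sup id` the recursion over `A` only reaches indices that are still `≥ N`.
  have hc : 0 < x ^ (N + A.sup id) := pow_pos hx _
  refine ⟨_, hc, N, fun n => ?_⟩
  induction n using Nat.strong_induction_on with
  | _ n ih =>
    intro hn hdvd
    rcases le_total n (N + A.sup id) with hsmall | hlarge
    · calc x ^ (N + A.sup id) ≤ x ^ n := pow_le_pow_of_le_one hx.le hx1 hsmall
        _ ≤ compositionCount S n * x ^ n :=
          le_mul_of_one_le_left (pow_nonneg hx.le n) (by exact_mod_cast hN n hn hdvd)
    · have hA (a : ℕ) (ha : a ∈ A) : 0 < a ∧ a ≤ A.sup id :=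
        ⟨hS a (hAS ha), Finset.le_sup (f := id) ha⟩
      refine le_compositionCount_mul_pow hx.le hAS (fun a ha => ?_) hsum hc.le fun a ha => ?_
      · exact Finset.mem_Icc.2 ⟨(hA a ha).1, by grind⟩
      · exact ih (n - a) (by grind) (by grind)
          (Nat.dvd_sub hdvd (Nat.setGcd_dvd_of_mem (hAS ha)))

theorem exists_lt_one_lt_sum_pow {A : Finset ℕ} (hβ : 0 < β) (hsum : 1 < ∑ a ∈ A, β ^ a) :
    ∃ x ∈ Set.Ioo 0 β, 1 < ∑ a ∈ A, x ^ a := by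
  have hcont : Continuous fun x : ℝ => ∑ a ∈ A, x ^ a := by fun_prop
  have hev : ∀ᶠ x in nhdsWithin β (Set.Iio β), 1 < ∑ a ∈ A, x ^ a :=
    (hcont.continuousAt.eventually_const_lt hsum).filter_mono nhdsWithin_le_nhds
  obtain ⟨x, hx, hxsum⟩ := (Filter.Eventually.and (Ioo_mem_nhdsLT hβ) hev).exists
  exact ⟨x, hx, hxsum⟩

theorem tendsto_compositionCount_div_atTop (hS : ∀ a ∈ S, 0 < a) (hT : ∀ a ∈ T, 0 < a)
    (hgcd : Nat.setGcd T ∣ Nat.setGcd S) (hβ : 0 < β) (hβ1 : β ≤ 1)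
    (hTsum : ∀ B : Finset ℕ, (B : Set ℕ) ⊆ T → ∑ b ∈ B, β ^ b ≤ 1)
    {A : Finset ℕ} (hAS : (A : Set ℕ) ⊆ S) (hAsum : 1 < ∑ a ∈ A, β ^ a) :
    Tendsto (fun n => (compositionCount S n / compositionCount T n : ℝ))
      (atTop ⊓ 𝓟 {n | Nat.setGcd S ∣ n}) atTop := by
  obtain ⟨x, ⟨hx, hxβ⟩, hxsum⟩ := exists_lt_one_lt_sum_pow hβ hAsum
  obtain ⟨c, hc, N, hlower⟩ :=
    exists_pos_le_compositionCount_mul_pow hS hx (hxβ.le.trans hβ1) hAS hxsum.le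
  obtain ⟨N', hpos⟩ := exists_forall_ge_compositionCount_pos hT
  have hgeom : Tendsto (fun n : ℕ => c * (β / x) ^ n) atTop atTop :=
    (tendsto_pow_atTop_atTop_of_one_lt ((one_lt_div hx).2 hxβ)).const_mul_atTop hc
  refine tendsto_atTop_mono' _ (eventually_inf_principal.2 ?_) (hgeom.mono_left inf_le_left)
  filter_upwards [eventually_ge_atTop N, eventually_ge_atTop N'] with n hn hn' hdvd
  have hTn : (0 : ℝ) < compositionCount T n := by exact_mod_cast hpos n hn' (hgcd.trans hdvd)
  have hxn : 0 < x ^ n := pow_pos hx n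
  rw [le_div_iff₀ hTn]
  calc c * (β / x) ^ n * compositionCount T n
      = c / x ^ n * (compositionCount T n * β ^ n) := by rw [div_pow]; ring
    _ ≤ c / x ^ n := mul_le_of_le_one_right (div_pos hc hxn).le
        (compositionCount_mul_pow_le_one hβ.le hTsum n)
    _ ≤ compositionCount S n := (div_le_iff₀ hxn).2 (hlower n hn hdvd)

end Growth

section CharacteristicRoot

variable {T : Set ℕ} {x β : ℝ}

theorem summable_pow_of_injective {ι : Type*} {u : ι → ℕ} (hu : Function.Injective u)
    (hx : 0 ≤ x) (hx1 : x < 1) : Summable fun i => x ^ u i :=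
  (summable_geometric_of_lt_one hx hx1).comp_injective hu

theorem sum_pow_le_of_hasSum {s : ℝ} (hx : 0 ≤ x) (hsum : HasSum (fun a : T => x ^ (a : ℕ)) s)
    {A : Finset ℕ} (hA : (A : Set ℕ) ⊆ T) : ∑ a ∈ A, x ^ a ≤ s := by
  classical
  rw [← Finset.sum_subtype_of_mem (p := (· ∈ T)) (fun a => x ^ a) hA]
  exact sum_le_hasSum _ (fun a _ => pow_nonneg hx a) hsum

theorem exists_hasSum_pow_eq_one (hT : ∀ a ∈ T, 0 < a) (hT2 : T.Nontrivial) :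
    ∃ β ∈ Set.Ioo (0 : ℝ) 1, HasSum (fun a : T => β ^ (a : ℕ)) 1 := by
  obtain ⟨a, ha, b, hb, hab⟩ := hT2
  obtain ⟨r, ⟨hr0, hr1⟩, hr⟩ : ∃ r ∈ Set.Ioo (0 : ℝ) 1, 1 < ∑ c ∈ {a, b}, r ^ c :=
    exists_lt_one_lt_sum_pow one_pos (by norm_num [Finset.sum_pair hab])
  have hsummable {x : ℝ} (hx : 0 ≤ x) (hxr : x ≤ r) : Summable fun a : T => x ^ (a : ℕ) :=
    summable_pow_of_injective Subtype.val_injective hx (hxr.trans_lt hr1)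
  have hcont : ContinuousOn (fun x : ℝ => ∑' a : T, x ^ (a : ℕ)) (Set.Icc 0 r) := by
    refine continuousOn_tsum (fun a => (continuous_pow _).continuousOn)
      (hsummable hr0.le le_rfl) fun a x hx => ?_
    rw [norm_pow, Real.norm_of_nonneg hx.1]
    exact pow_le_pow_left₀ hx.1 hx.2 _
  have hzero : ∑' a : T, (0 : ℝ) ^ (a : ℕ) = 0 := by
    simp [fun a : T => (hT a a.2).ne']
  have hone_le : 1 ≤ ∑' a : T, r ^ (a : ℕ) :=
    hr.le.trans <| sum_pow_le_of_hasSum hr0.le (hsummable hr0.le le_rfl).hasSum <| by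
      simp [Set.insert_subset_iff, ha, hb]
  obtain ⟨β, ⟨hβ0, hβr⟩, hβ : ∑' a : T, β ^ (a : ℕ) = 1⟩ :=
    intermediate_value_Icc hr0.le hcont ⟨hzero.trans_le zero_le_one, hone_le⟩
  have hβ_ne : β ≠ 0 := by
    rintro rfl
    exact zero_ne_one (hzero.symm.trans hβ)
  exact ⟨β, ⟨hβ0.lt_of_ne' hβ_ne, hβr.trans_lt hr1⟩, hβ ▸ (hsummable hβ0 hβr).hasSum⟩

theorem exists_finset_subset_image_one_lt_sum_pow {φ : ℕ → ℕ} (hinj : Set.InjOn φ T)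
    (hle : ∀ a ∈ T, φ a ≤ a) (hlt : ∃ a ∈ T, φ a < a) (hβ : β ∈ Set.Ioo (0 : ℝ) 1)
    (hsum : HasSum (fun a : T => β ^ (a : ℕ)) 1) :
    ∃ A : Finset ℕ, (A : Set ℕ) ⊆ φ '' T ∧ 1 < ∑ a ∈ A, β ^ a := by
  have hinj' : Function.Injective fun a : T => φ a := hinj.injective
  have hφ : HasSum (fun a : T => β ^ φ a) (∑' a : T, β ^ φ a) :=
    (summable_pow_of_injective hinj' hβ.1.le hβ.2).hasSum
  have hone_lt : 1 < ∑' a : T, β ^ φ a := by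
    obtain ⟨a, ha, halt⟩ := hlt
    have hterm (b : T) : β ^ (b : ℕ) ≤ β ^ φ b := pow_le_pow_of_le_one hβ.1.le hβ.2.le (hle b b.2)
    have hterm_lt : β ^ a < β ^ φ a := pow_lt_pow_right_of_lt_one₀ hβ.1 hβ.2 halt
    exact hasSum_lt (i := ⟨a, ha⟩) hterm hterm_lt hsum hφ
  obtain ⟨B, hB⟩ := (hφ.eventually_const_lt hone_lt).exists
  refine ⟨B.map ⟨_, hinj'⟩, ?_, by rwa [Finset.sum_map]⟩
  rintro _ h
  obtain ⟨a, -, rfl⟩ := Finset.mem_map.1 h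
  exact Set.mem_image_of_mem φ a.2

end CharacteristicRoot

section Parts

theorem setGcd_fibParts (k : ℕ) : Nat.setGcd (fibParts k) = 1 :=
  Nat.eq_one_of_dvd_coprimes (Nat.fib_coprime_fib_succ k)
    (Nat.setGcd_dvd_of_mem ⟨k, le_rfl, rfl⟩) (Nat.setGcd_dvd_of_mem ⟨k + 1, k.le_succ, rfl⟩)

theorem fibParts_nontrivial (k : ℕ) : (fibParts k).Nontrivial :=
  ⟨Nat.fib (k + 2), ⟨k + 2, by lia, rfl⟩, Nat.fib (k + 3), ⟨k + 3, by lia, rfl⟩,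
    (Nat.fib_lt_fib_succ (by lia)).ne⟩

theorem exists_injOn_mapsTo_fibParts_polyParts {P : Polynomial ℝ} {k : ℕ}
    (hint : ∀ i : ℕ, k ≤ i → ∃ a : ℕ, 0 < a ∧ P.eval (i : ℝ) = a)
    (hinj : Set.InjOn (fun i : ℕ => P.eval (i : ℝ)) (Set.Ici k))
    (hfib : ∀ i : ℕ, k ≤ i → P.eval (i : ℝ) < Nat.fib i) :
    ∃ φ : ℕ → ℕ, Set.MapsTo φ (fibParts k) (polyParts P k) ∧ Set.InjOn φ (fibParts k) ∧
      ∀ a ∈ fibParts k, φ a < a := by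
  choose! p hp_pos hp using hint
  have hp_lt (i : ℕ) (hi : k ≤ i) : p i < Nat.fib i := by
    exact_mod_cast hp i hi ▸ hfib i hi
  have hindex (i : ℕ) (hi : k ≤ i) : Nat.greatestFib (Nat.fib i) = i := by
    refine Nat.greatestFib_fib ?_
    rintro rfl
    exact (hp_lt 1 hi).not_ge (hp_pos 1 hi)
  refine ⟨p ∘ Nat.greatestFib, ?_, ?_, ?_⟩
  · rintro _ ⟨i, hi, rfl⟩
    exact ⟨i, hi, by rw [Function.comp_apply, hindex i hi, hp i hi]⟩
  · rintro _ ⟨i, hi, rfl⟩ _ ⟨j, hj, rfl⟩ hij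
    simp only [Function.comp_apply, hindex i hi, hindex j hj] at hij
    have heval : P.eval (i : ℝ) = P.eval (j : ℝ) := by rw [hp i hi, hp j hj, hij]
    rw [hinj hi hj heval]
  · rintro _ ⟨i, hi, rfl⟩
    simpa only [Function.comp_apply, hindex i hi] using hp_lt i hi

theorem pos_of_mem_polyParts {P : Polynomial ℝ} {k : ℕ}
    (hpos : ∀ i : ℕ, k ≤ i → 0 < P.eval (i : ℝ)) : ∀ a ∈ polyParts P k, 0 < a := by
  rintro a ⟨i, hi, ha⟩
  exact_mod_cast ha ▸ hpos i hi

end Parts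

theorem tendsto_mul_left_atTop_inf_principal_dvd {d : ℕ} (hd : 0 < d) :
    Tendsto (d * ·) atTop (atTop ⊓ 𝓟 {n | d ∣ n}) :=
  tendsto_inf.2 ⟨tendsto_id.const_mul_atTop' hd,
    tendsto_principal.2 (Eventually.of_forall fun n => dvd_mul_right d n)⟩

theorem theorem4p3_general {S T : Set ℕ} (hS : ∀ a ∈ S, 0 < a) (hT : T.Nontrivial) {φ : ℕ → ℕ}
    (hmaps : Set.MapsTo φ T S) (hinj : Set.InjOn φ T) (hle : ∀ a ∈ T, φ a ≤ a)
    (hlt : ∃ a ∈ T, φ a < a) (hgcd : Nat.setGcd T ∣ Nat.setGcd S) :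
    Tendsto
        (fun n : ℕ =>
          (compositionCount S (Nat.setGcd S * n) : ℝ) / compositionCount T (Nat.setGcd S * n))
        atTop atTop ∧
      (Nat.setGcd S = 1 →
        Tendsto (fun n : ℕ => (compositionCount S n : ℝ) / compositionCount T n) atTop atTop) := by
  have hTpos (a : ℕ) (ha : a ∈ T) : 0 < a := (hS _ (hmaps ha)).trans_le (hle a ha)
  obtain ⟨β, hβ, hsum⟩ := exists_hasSum_pow_eq_one hTpos hT
  obtain ⟨A, hAT, hAsum⟩ := exists_finset_subset_image_one_lt_sum_pow hinj hle hlt hβ hsum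
  have hdvd := tendsto_compositionCount_div_atTop hS hTpos hgcd hβ.1 hβ.2.le
    (fun _ hB => sum_pow_le_of_hasSum hβ.1.le hsum hB) (hAT.trans hmaps.image_subset) hAsum
  have hgcd_pos : 0 < Nat.setGcd S :=
    have ⟨a, ha, _⟩ := hlt
    Nat.pos_of_dvd_of_pos (Nat.setGcd_dvd_of_mem (hmaps ha)) (hS _ (hmaps ha))
  have hmul := hdvd.comp (tendsto_mul_left_atTop_inf_principal_dvd hgcd_pos)
  exact ⟨hmul, fun hone => by simpa only [Function.comp_def, hone, one_mul] using hmul⟩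

theorem theorem4p3 (P : Polynomial ℝ) (hlead : 0 < P.leadingCoeff) (m : ℕ)
    (hint : ∀ i : ℕ, m ≤ i → ∃ a : ℕ, 0 < a ∧ P.eval (i : ℝ) = (a : ℝ))
    (hmono : ∀ i j : ℕ, m ≤ i → i < j → P.eval (i : ℝ) < P.eval (j : ℝ))
    (hfib : ∀ i : ℕ, m ≤ i → P.eval (i : ℝ) < (Nat.fib i : ℝ))
    (k : ℕ) (hk : m ≤ k) :
    Tendsto
        (fun n : ℕ =>
          (compositionCount (polyParts P k) (Nat.setGcd (polyParts P k) * n) : ℝ) /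
            (compositionCount (fibParts k) (Nat.setGcd (polyParts P k) * n) : ℝ))
        atTop atTop ∧
      (Nat.setGcd (polyParts P k) = 1 →
        Tendsto
          (fun n : ℕ =>
            (compositionCount (polyParts P k) n : ℝ) / (compositionCount (fibParts k) n : ℝ))
          atTop atTop) := by
  have hinj : Set.InjOn (fun i : ℕ => P.eval (i : ℝ)) (Set.Ici k) :=
    StrictMonoOn.injOn fun i hi j _ hij => hmono i j (hk.trans hi) hij
  have hpos (i : ℕ) (hi : k ≤ i) : 0 < P.eval (i : ℝ) :=
    have ⟨_, ha, h⟩ := hint i (hk.trans hi)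
    h ▸ Nat.cast_pos.2 ha
  obtain ⟨φ, hmaps, hφinj, hlt⟩ := exists_injOn_mapsTo_fibParts_polyParts
    (fun i hi => hint i (hk.trans hi)) hinj fun i hi => hfib i (hk.trans hi)
  have hfibParts := fibParts_nontrivial k
  exact theorem4p3_general (pos_of_mem_polyParts hpos) hfibParts hmaps hφinj
    (fun a ha => (hlt a ha).le) (hfibParts.nonempty.imp fun a ha => ⟨ha, hlt a ha⟩)
    (setGcd_fibParts k ▸ one_dvd _)
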